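/- Let $\mathbb{N}=\{1,2,\dots\}$ and identify $\mathbb{R}^n$ with the set of $u\in\mathbb{R}^{\mathbb{N}}$ such that $u_i=0$ for all $i>n$; put $\mathbb{Z}^n=\mathbb{R}^n\cap\mathbb{Z}^{\mathbb{N}}$. Let $\mathrm{Sym}(n)$ be the group of permutations of $\mathbb{N}$ fixing every $i>n$, acting on $\mathbb{R}^{\mathbb{N}}$ by $\sigma(u)=(u_{\sigma^{-1}(i)})_{i\ge 1}$, and put $\mathrm{Sym}(n)(A)=\{\sigma(u)\mid \sigma\in\mathrm{Sym}(n),\,u\in A\}$. For a set $A$ of vectors, let $\mathrm{cn}(A)$ be the set of all finite linear combinations of elements of $A$ with coefficients in $\mathbb{R}_{\ge0}$, and let $\mathrm{mn}(A)$ be the set of those with coefficients in $\mathbb{Z}_{\ge0}$. A cone is a set $C$ with $C=\mathrm{cn}(C)$. It is finitely generated if $C=\mathrm{cn}(A)$ for some finite set $A$, and rational if $C=\mathrm{cn}(A)$ for some set $A$ of vectors with rational coordinates. A monoid $M\subseteq\mathbb{Z}^n$ is a set with $M=\mathrm{mn}(M)$. It is finitely generated if $M=\mathrm{mn}(A)$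 for some finite set $A$, and normal if $M=\{u\in\mathbb{Z}^{\mathbb{N}}\mid ku\in M\text{ for some integer }k\ge1\}$. A chain $(C_n)_{n\ge1}$ of cones $C_n\subseteq\mathbb{R}^n$ is $\mathrm{Sym}$-invariant if $\mathrm{cn}(\mathrm{Sym}(n)(C_m))\subseteq C_n$ for all $n\ge m\ge1$. A $\mathrm{Sym}$-invariant chain is stabilizing if there is an integer $r\ge1$ such that $C_n=\mathrm{cn}(\mathrm{Sym}(n)(C_m))$ for all $n\ge m\ge r$. The same notions for chains $(M_n)_{n\ge1}$ of monoids $M_n\subseteq\mathbb{Z}^n$ are defined with $\mathrm{mn}$ in place of $\mathrm{cn}$. **Corollary.** Let $(C_n)_{n\ge1}$ be a stabilizing $\mathrm{Sym}$-invariant chain of finitely generated rational cones with $C_n\subseteq\mathbb{R}^n_{\ge0}$ for all $n\ge1$. Then $(M_n)_{n\ge1}$ with $M_n=C_n\cap\mathbb{Z}^n$ for $n\ge1$ is a stabilizing $\mathrm{Sym}$-invariant chain of finitely generated normal monoids. -/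

import Mathlib

namespace SymGordan

/-- The coordinates are indexed by `ℕ = {0, 1, 2, …}`, so that `[n]` is `{0, …, n - 1}`.
`coordSubspace R n` is `R^n`, regarded as the set of those `u` in `R^ℕ` whose coordinates outside
of `[n]` vanish. -/
def coordSubspace (R : Type*) [Zero R] (n : ℕ) : Set (ℕ → R) :=
  {u | ∀ i, n ≤ i → u i = 0}

/-- `Sym(n)`, as the subgroup of the permutations of `ℕ` that fix everything outside of `[n]`. -/
def symGroup (n : ℕ) : Subgroup (Equiv.Perm ℕ) where
  carrier := {σ | ∀ i, n ≤ i → σ i = i}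
  mul_mem' := by
    intro a b ha hb i hi
    rw [Equiv.Perm.mul_apply, hb i hi, ha i hi]
  one_mem' := fun _ _ => rfl
  inv_mem' := by
    intro a ha i hi
    rw [Equiv.Perm.inv_eq_iff_eq, ha i hi]

/-- The action of permutations on sequences: `σ(u) = (u_{σ⁻¹(i)})_i`. -/
def permAct {R : Type*} (σ : Equiv.Perm ℕ) (u : ℕ → R) : ℕ → R :=
  fun i => u (σ⁻¹ i)

/-- `Sym(n)(A) = {σ(u) | σ ∈ Sym(n), u ∈ A}`. -/
def symOrbit {R : Type*} (n : ℕ) (A : Set (ℕ → R)) : Set (ℕ → R) :=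
  {v | ∃ σ ∈ symGroup n, ∃ u ∈ A, v = permAct σ u}

/-- A `Sym`-invariant chain `(C_n)_{n ≥ 1}` of cones `C_n ⊆ ℝ^n`
(the value of `C` at `0` is irrelevant). -/
structure IsSymInvariantConeChain (C : ℕ → PointedCone ℝ (ℕ → ℝ)) : Prop where
  subset_coord : ∀ n, 1 ≤ n → (C n : Set (ℕ → ℝ)) ⊆ coordSubspace ℝ n
  invariant : ∀ m n, 1 ≤ m → m ≤ n →
    PointedCone.hull ℝ (symOrbit n (C m : Set (ℕ → ℝ))) ≤ C n

/-- The chain of cones stabilizes: `C_n = cn(Sym(n)(C_m))` for all `n ≥ m ≥ r`, for some `r ≥ 1`. -/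
def ConeChainStabilizes (C : ℕ → PointedCone ℝ (ℕ → ℝ)) : Prop :=
  ∃ r, 1 ≤ r ∧ ∀ m n, r ≤ m → m ≤ n →
    C n = PointedCone.hull ℝ (symOrbit n (C m : Set (ℕ → ℝ)))

/-- A cone is rational if it is generated by elements with rational coordinates. -/
def IsRationalCone (C : PointedCone ℝ (ℕ → ℝ)) : Prop :=
  ∃ A : Set (ℕ → ℝ), (∀ a ∈ A, ∀ i, ∃ q : ℚ, a i = (q : ℝ)) ∧ C = PointedCone.hull ℝ A

/-- A `Sym`-invariant chain `(M_n)_{n ≥ 1}` of monoids `M_n ⊆ ℤ^n`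
(the value of `M` at `0` is irrelevant). -/
structure IsSymInvariantMonoidChain (M : ℕ → AddSubmonoid (ℕ → ℤ)) : Prop where
  subset_coord : ∀ n, 1 ≤ n → (M n : Set (ℕ → ℤ)) ⊆ coordSubspace ℤ n
  invariant : ∀ m n, 1 ≤ m → m ≤ n →
    AddSubmonoid.closure (symOrbit n (M m : Set (ℕ → ℤ))) ≤ M n

/-- The chain of monoids stabilizes: `M_n = mn(Sym(n)(M_m))` for all `n ≥ m ≥ r`,
for some `r ≥ 1`. -/
def MonoidChainStabilizes (M : ℕ → AddSubmonoid (ℕ → ℤ)) : Prop :=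
  ∃ r, 1 ≤ r ∧ ∀ m n, r ≤ m → m ≤ n →
    M n = AddSubmonoid.closure (symOrbit n (M m : Set (ℕ → ℤ)))

/-- The normalization `{u | k u ∈ M for some integer k ≥ 1}` of a monoid `M` of integer
sequences. -/
def normalization (M : AddSubmonoid (ℕ → ℤ)) : Set (ℕ → ℤ) :=
  {u | ∃ k : ℕ, 1 ≤ k ∧ k • u ∈ M}

/-- A monoid of integer sequences is normal if it equals its normalization. -/
def IsNormalMonoid (M : AddSubmonoid (ℕ → ℤ)) : Prop :=
  (M : Set (ℕ → ℤ)) = normalization M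

/-- The monoid `C ∩ ℤ^n`. -/
def latticePoints (n : ℕ) (C : PointedCone ℝ (ℕ → ℝ)) : AddSubmonoid (ℕ → ℤ) where
  carrier := {u | u ∈ coordSubspace ℤ n ∧ (fun i => (u i : ℝ)) ∈ C}
  zero_mem' := by
    refine ⟨fun _ _ => rfl, ?_⟩
    have h : (fun i => (((0 : ℕ → ℤ) i : ℤ) : ℝ)) = 0 := by
      funext i
      simp
    rw [h]
    exact C.zero_mem
  add_mem' := by
    rintro a b ⟨ha, ha'⟩ ⟨hb, hb'⟩
    refine ⟨fun i hi => ?_, ?_⟩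
    · rw [Pi.add_apply, ha i hi, hb i hi, add_zero]
    · have h : (fun i => (((a + b) i : ℤ) : ℝ)) =
          (fun i => (a i : ℝ)) + (fun i => (b i : ℝ)) := by
        funext i
        simp
      rw [h]
      exact C.add_mem ha' hb'

end SymGordan

/-!
Since `C_n` is generated by `Sym(n)(C_r)`, Carathéodory's theorem writes `u ∈ C_n` as a positive
combination of at most `#(support u) + 1` vectors, each with at most `r` nonzero entries, all of
them (by nonnegativity) at positions in `support u`. If `#(support u) > r ^ 2 + 1`, these vectors
are too few to cover all pairs of positions, so there are `i ≠ j` in `support u` such that none of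
them is nonzero at both. Swapping `i` and `j` in those which are nonzero at `i` moves the whole
entry `u i` onto `j`, and the result still lies in `C_n`.

Conversely, a point on the segment from `u` to the sequence with `u i` and `u j` interchanged stays
in every convex symmetric set. Such transfers preserve the coordinate sum, and being closed under
them passes from a set to the monoid it generates. Moving an entry back from `j` to `i` is one of
them, so by induction on the size of the support, `M_n` is generated by elements of coordinate sum
at most `K` as soon as its elements with at most `R = r ^ 2 + 1` nonzero entries are. The latter
lie in `Sym(n)(M_R)`, so it is enough that `K` bounds the coordinate sums of a finite generating
set of `M_R`, which exists by Gordan's lemma. A lattice point of coordinate sum at most `K` has at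
most `K` nonzero entries, hence lies in `Sym(n)(M_m)` for all `m ≥ max R K`.
-/

namespace SymGordan

open Finset

section Transfer

variable {ι R : Type*} [DecidableEq ι] [AddCommGroup R]

/-- The sequence obtained from `u` by moving the amount `t` from the coordinate `i` to the
coordinate `j`. -/
def transfer (i j : ι) (t : R) (u : ι → R) : ι → R :=
  u - Pi.single i t + Pi.single j t

theorem transfer_add_add (i j : ι) (s t : R) (u v : ι → R) :
    transfer i j (s + t) (u + v) = transfer i j s u + transfer i j t v := by
  simp only [transfer, Pi.single_add]
  abel

theorem transfer_transfer_symm (i j : ι) (t : R) (u : ι → R) :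
    transfer j i t (transfer i j t u) = u := by
  simp only [transfer]
  abel

theorem transfer_apply_of_ne {i j h : ι} (hi : h ≠ i) (hj : h ≠ j) (t : R) (u : ι → R) :
    transfer i j t u h = u h := by
  simp [transfer, hi, hj]

theorem transfer_apply_left {i j : ι} (hij : i ≠ j) (t : R) (u : ι → R) :
    transfer i j t u i = u i - t := by
  simp [transfer, hij]

theorem transfer_apply_right {i j : ι} (hij : i ≠ j) (t : R) (u : ι → R) :
    transfer i j t u j = u j + t := by
  simp [transfer, hij.symm]

theorem transfer_sub_eq_comp_swap (i j : ι) (u : ι → R) :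
    transfer i j (u i - u j) u = u ∘ Equiv.swap i j := by
  rcases eq_or_ne i j with rfl | hij
  · simp [transfer]
  funext h
  rcases eq_or_ne h i with rfl | hi
  · simp [transfer_apply_left hij]
  rcases eq_or_ne h j with rfl | hj
  · simp [transfer_apply_right hij]
  · simp [transfer_apply_of_ne hi hj, Equiv.swap_apply_of_ne_of_ne hi hj]

theorem sum_transfer {s : Finset ι} {i j : ι} (hi : i ∈ s) (hj : j ∈ s) (t : R) (u : ι → R) :
    ∑ h ∈ s, transfer i j t u h = ∑ h ∈ s, u h := by
  simp [transfer, sum_add_distrib, sum_sub_distrib, Pi.single_apply, hi, hj]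

theorem support_transfer_self_ssubset {i j : ι} (hij : i ≠ j) {u : ι → R} (hi : u i ≠ 0)
    (hj : u j ≠ 0) : Function.support (transfer i j (u i) u) ⊂ Function.support u := by
  refine (Set.ssubset_iff_of_subset fun h hh => ?_).2
    ⟨i, hi, by simp [transfer_apply_left hij]⟩
  rcases eq_or_ne h i with rfl | hhi
  · exact hi
  rcases eq_or_ne h j with rfl | hhj
  · exact hj
  · rwa [Function.mem_support, transfer_apply_of_ne hhi hhj] at hh

end Transfer

section TransferClosed

variable {ι R : Type*} [DecidableEq ι] [AddCommGroup R] [LinearOrder R]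

/-- A set of sequences is closed under transfers on `S` if it contains, with every `u`, all
sequences lying on the segment from `u` to the sequence with the entries `u i` and `u j`
interchanged, for all `i, j ∈ S`. -/
def IsTransferClosed (S : Set ι) (G : Set (ι → R)) : Prop :=
  ∀ i ∈ S, ∀ j ∈ S, ∀ u ∈ G, ∀ t ∈ Set.uIcc 0 (u i - u j), transfer i j t u ∈ G

theorem exists_add_eq_of_mem_uIcc_zero_add [IsOrderedAddMonoid R] {a b t : R}
    (ht : t ∈ Set.uIcc 0 (a + b)) :
    ∃ x ∈ Set.uIcc 0 a, ∃ y ∈ Set.uIcc 0 b, x + y = t := by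
  simp only [Set.mem_uIcc] at ht ⊢
  by_cases h : (0 ≤ t ∧ t ≤ a) ∨ (a ≤ t ∧ t ≤ 0)
  · exact ⟨t, h, 0, by grind, add_zero t⟩
  by_cases h' : (0 ≤ t ∧ t ≤ b) ∨ (b ≤ t ∧ t ≤ 0)
  · exact ⟨0, by grind, t, h', zero_add t⟩
  · exact ⟨a, by grind, t - a, by grind, add_sub_cancel a t⟩

theorem IsTransferClosed.closure [IsOrderedAddMonoid R] {S : Set ι} {G : Set (ι → R)}
    (hG : IsTransferClosed S G) :
    IsTransferClosed S (AddSubmonoid.closure G : Set (ι → R)) := by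
  intro i hi j hj u hu
  induction hu using AddSubmonoid.closure_induction with
  | mem w hw => exact fun t ht => AddSubmonoid.subset_closure (hG i hi j hj w hw t ht)
  | zero =>
    intro t ht
    obtain rfl : t = 0 := by simpa using ht
    simp [transfer]
  | add x y _ _ hx hy =>
    intro t ht
    rw [Pi.add_apply, Pi.add_apply, add_sub_add_comm] at ht
    obtain ⟨a, ha, b, hb, rfl⟩ := exists_add_eq_of_mem_uIcc_zero_add ht
    rw [transfer_add_add]
    exact add_mem (hx a ha) (hy b hb)

/-- Undoing the transfer of a whole entry is a transfer towards balance, so membership in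
`closure G` can be checked after emptying coordinates one by one. -/
theorem subset_closure_of_exists_transfer_self_mem [IsOrderedAddMonoid R] {S : Set ι}
    {M G : Set (ι → R)} {k : ℕ} (hG : IsTransferClosed S G) (hM : ∀ u ∈ M, 0 ≤ u)
    (htransfer : ∀ u ∈ M, k < (Function.support u).ncard →
      ∃ i ∈ S, ∃ j ∈ S, i ≠ j ∧ u i ≠ 0 ∧ u j ≠ 0 ∧ transfer i j (u i) u ∈ M)
    (hbase : ∀ u ∈ M, (Function.support u).ncard ≤ k → u ∈ AddSubmonoid.closure G) :
    M ⊆ AddSubmonoid.closure G := by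
  intro u hu
  induction hN : (Function.support u).ncard using Nat.strong_induction_on generalizing u with
  | _ N ih =>
    rcases le_or_gt (Function.support u).ncard k with hk | hk
    · exact hbase u hu hk
    obtain ⟨i, hi, j, hj, hij, hui, huj, hv⟩ := htransfer u hu hk
    have hlt : (Function.support (transfer i j (u i) u)).ncard < N :=
      hN ▸ Set.ncard_lt_ncard (support_transfer_self_ssubset hij hui huj)
        (Set.finite_of_ncard_pos (Nat.zero_lt_of_lt hk))
    rw [← transfer_transfer_symm i j (u i) u]
    refine hG.closure j hj i hi _ (ih _ hlt hv rfl) (u i) ?_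
    rw [transfer_apply_left hij, transfer_apply_right hij, sub_self, sub_zero]
    exact Set.mem_uIcc_of_le (hM u hu i) (le_add_of_nonneg_left (hM u hu j))

theorem isTransferClosed_of_convex {𝕜 : Type*} [Field 𝕜] [LinearOrder 𝕜]
    [IsStrictOrderedRing 𝕜] {S : Set ι} {C : Set (ι → 𝕜)} (hC : Convex 𝕜 C)
    (hswap : ∀ i ∈ S, ∀ j ∈ S, ∀ u ∈ C, u ∘ Equiv.swap i j ∈ C) : IsTransferClosed S C := by
  intro i hi j hj u hu t ht
  rw [← segment_eq_uIcc] at ht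
  obtain ⟨a, b, ha, hb, hab, rfl⟩ := ht
  obtain rfl : a = 1 - b := eq_sub_of_add_eq hab
  convert hC hu (hswap i hi j hj u hu) ha hb hab using 1
  rw [← transfer_sub_eq_comp_swap]
  ext h
  simp only [transfer, Pi.add_apply, Pi.sub_apply, Pi.smul_apply, Pi.single_apply, smul_eq_mul]
  split_ifs <;> ring

end TransferClosed

section SparseRepresentation

universe u

theorem exists_affineIndependent_of_mem_hull {𝕜 : Type*} {E : Type u} [Field 𝕜] [LinearOrder 𝕜]
    [IsStrictOrderedRing 𝕜] [AddCommGroup E] [Module 𝕜 E] {S : Set E} {x : E}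
    (hx : x ∈ PointedCone.hull 𝕜 S) :
    ∃ (κ : Type u) (_ : Fintype κ) (z : κ → E) (w : κ → 𝕜), (∀ k, z k ∈ S) ∧
      AffineIndependent 𝕜 z ∧ (∀ k, 0 < w k) ∧ ∑ k, w k • z k = x := by
  obtain ⟨c, hcS, hc, rfl⟩ := PointedCone.mem_hull_set.1 hx
  rcases (sum_nonneg fun y (_ : y ∈ c.support) => hc y).eq_or_lt with h0 | hpos
  · have hc0 : ∀ y ∈ c.support, c y = 0 := (sum_eq_zero_iff_of_nonneg fun y _ => hc y).1 h0.symm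
    refine ⟨PEmpty, inferInstance, PEmpty.elim, PEmpty.elim, fun k => k.elim,
      affineIndependent_of_subsingleton 𝕜 _, fun k => k.elim, ?_⟩
    exact (sum_eq_zero fun y hy => by simp only [hc0 y hy, zero_smul]).symm
  · obtain ⟨κ, _, z, w, hz, haff, hw, -, hsum⟩ := eq_pos_convex_span_of_mem_convexHull
      (c.support.centerMass_mem_convexHull (z := id) (fun y _ => hc y) hpos fun y hy => hcS hy)
    refine ⟨κ, inferInstance, z, fun k => (∑ y ∈ c.support, c y) * w k,
      fun k => hz (Set.mem_range_self k), haff, fun k => mul_pos hpos (hw k), ?_⟩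
    simp only [mul_smul, ← smul_sum, hsum, centerMass, smul_inv_smul₀ hpos.ne', id, Finsupp.sum]

theorem card_le_card_add_one_of_affineIndependent {𝕜 ι κ : Type*} [DivisionRing 𝕜]
    [Fintype κ] {z : κ → ι → 𝕜} (hz : AffineIndependent 𝕜 z) {S : Finset ι}
    (hS : ∀ k, Function.support (z k) ⊆ S) : Fintype.card κ ≤ #S + 1 := by
  have hext : z =
      (Function.ExtendByZero.linearMap 𝕜 ((↑) : S → ι)).toAffineMap ∘ fun k s => z k s := by
    funext k
    ext i
    by_cases hi : i ∈ S
    · exact (Subtype.val_injective.extend_apply (fun s : S => z k s) 0 ⟨i, hi⟩).symm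
    · have hi' : ¬∃ s : S, (s : ι) = i := by simpa using hi
      exact (Function.notMem_support.1 (mt (@hS k i) hi)).trans
        (Function.extend_apply' (fun s : S => z k s) (0 : ι → 𝕜) i hi').symm
  rw [hext] at hz
  calc Fintype.card κ ≤ Module.finrank 𝕜 (vectorSpan 𝕜 (Set.range fun k (s : S) => z k s)) + 1 :=
        (AffineIndependent.of_comp _ hz).card_le_finrank_succ
    _ ≤ Module.finrank 𝕜 (S → 𝕜) + 1 := by gcongr; exact Submodule.finrank_le _
    _ = #S + 1 := by rw [Module.finrank_fintype_fun_eq_card, Fintype.card_coe]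

theorem exists_ne_forall_notMem_or_notMem {ι κ : Type*} {t : Finset κ} {T : κ → Finset ι}
    {S : Finset ι} {r : ℕ} (hT : ∀ k ∈ t, #(T k) ≤ r) (ht : #t ≤ #S + 1) (hS : r ^ 2 + 1 < #S) :
    ∃ i ∈ S, ∃ j ∈ S, i ≠ j ∧ ∀ k ∈ t, i ∉ T k ∨ j ∉ T k := by
  classical
  by_contra! h
  have hsub : S.offDiag ⊆ t.biUnion fun k => (T k) ×ˢ (T k) := by
    rintro ⟨i, j⟩ hij
    obtain ⟨hi, hj, hne⟩ := mem_offDiag.1 hij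
    obtain ⟨k, hk, hik, hjk⟩ := h i hi j hj hne
    exact mem_biUnion.2 ⟨k, hk, mk_mem_product hik hjk⟩
  have hcount : #S * #S - #S ≤ (#S + 1) * r ^ 2 := by
    calc #S * #S - #S = #S.offDiag := (offDiag_card S).symm
      _ ≤ #t * r ^ 2 := (card_le_card hsub).trans <| card_biUnion_le_card_mul _ _ _ fun k hk => by
          rw [card_product, sq]
          exact Nat.mul_le_mul (hT k hk) (hT k hk)
      _ ≤ (#S + 1) * r ^ 2 := by gcongr
  rw [tsub_le_iff_right] at hcount
  nlinarith

theorem transfer_self_sum_mem {𝕜 ι κ : Type*} [DecidableEq ι] [CommRing 𝕜] [PartialOrder 𝕜]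
    [IsOrderedRing 𝕜] {C : PointedCone 𝕜 (ι → 𝕜)} {i j : ι} {s : Finset κ} {b : κ → ι → 𝕜}
    (hb : ∀ k ∈ s, b k ∈ C) (hswap : ∀ k ∈ s, b k ∘ Equiv.swap i j ∈ C)
    (hij : ∀ k ∈ s, b k i = 0 ∨ b k j = 0) :
    transfer i j ((∑ k ∈ s, b k) i) (∑ k ∈ s, b k) ∈ C := by
  refine sum_induction b (fun v => transfer i j (v i) v ∈ C) (fun v w hv hw => ?_) ?_ fun k hk => ?_
  · rw [Pi.add_apply, transfer_add_add]
    exact add_mem hv hw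
  · simp [transfer]
  · rcases hij k hk with hi | hj
    · simpa [transfer, hi] using hb k hk
    · simpa [← transfer_sub_eq_comp_swap, hj] using hswap k hk

theorem mem_hull_support_subset_of_mem_hull {𝕜 ι : Type*} [Semiring 𝕜] [LinearOrder 𝕜]
    [IsStrictOrderedRing 𝕜] {B : Set (ι → 𝕜)} (hB : ∀ b ∈ B, 0 ≤ b) {u : ι → 𝕜}
    (hu : u ∈ PointedCone.hull 𝕜 B) :
    u ∈ PointedCone.hull 𝕜 {b ∈ B | Function.support b ⊆ Function.support u} := by
  obtain ⟨c, hcB, hc, hsum⟩ := PointedCone.mem_hull_set.1 hu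
  have hsupp {b : ι → 𝕜} (hb : b ∈ c.support) : Function.support b ⊆ Function.support u := by
    intro i hi
    have hle : c b * b i ≤ u i := by
      rw [← hsum, Finsupp.sum, Finset.sum_apply]
      exact single_le_sum (f := fun b : ι → 𝕜 => c b * b i)
        (fun b' hb' => mul_nonneg (hc b') (hB b' (hcB hb') i)) hb
    have hpos : 0 < c b * b i := mul_pos ((hc b).lt_of_ne' (Finsupp.mem_support_iff.1 hb))
      ((hB b (hcB hb) i).lt_of_ne' hi)
    exact (hpos.trans_le hle).ne'
  rw [← hsum] at hsupp ⊢
  exact sum_mem fun b hb =>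
    PointedCone.smul_mem _ (hc b) (PointedCone.subset_hull ⟨hcB hb, hsupp hb⟩)

/-- There are at most `#(support u) + 1` elements of `B` in a representation of `u`, so their
supports do not cover all pairs of elements of `support u`. -/
theorem exists_transfer_self_mem_hull {𝕜 ι : Type*} [DecidableEq ι] [Field 𝕜] [LinearOrder 𝕜]
    [IsStrictOrderedRing 𝕜] {B : Set (ι → 𝕜)} {u : ι → 𝕜} {r : ℕ} (hB : ∀ b ∈ B, 0 ≤ b)
    (hr : ∀ b ∈ B, (Function.support b).ncard ≤ r)
    (hswap : ∀ i ∈ Function.support u, ∀ j ∈ Function.support u, ∀ b ∈ B, b ∘ Equiv.swap i j ∈ B)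
    (hu : u ∈ PointedCone.hull 𝕜 B) (hcard : r ^ 2 + 1 < (Function.support u).ncard) :
    ∃ i ∈ Function.support u, ∃ j ∈ Function.support u,
      i ≠ j ∧ transfer i j (u i) u ∈ PointedCone.hull 𝕜 B := by
  obtain ⟨S, hS⟩ := (Set.finite_of_ncard_pos (Nat.zero_lt_of_lt hcard)).exists_finset_coe
  obtain ⟨κ, _, z, w, hz, haff, hw, hsum⟩ :=
    exists_affineIndependent_of_mem_hull (mem_hull_support_subset_of_mem_hull hB hu)
  have hsupp (k : κ) : Function.support (z k) ⊆ S := hS ▸ (hz k).2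
  rw [← hS, Set.ncard_coe_finset] at hcard
  have hT (k : κ) : #{h ∈ S | z k h ≠ 0} ≤ r := by
    have hfilter : ({h ∈ S | z k h ≠ 0} : Finset ι) = Function.support (z k) := by
      rw [coe_filter]
      exact Set.ext fun h => and_iff_right_of_imp (@hsupp k h)
    rw [← Set.ncard_coe_finset, hfilter]
    exact hr _ (hz k).1
  obtain ⟨i, hi, j, hj, hij, hT'⟩ := exists_ne_forall_notMem_or_notMem (t := univ)
    (fun k _ => hT k) (card_le_card_add_one_of_affineIndependent haff hsupp) hcard
  rw [← hS] at hswap ⊢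
  rw [← hsum]
  refine ⟨i, hi, j, hj, hij, transfer_self_sum_mem (fun k _ => ?_) (fun k _ => ?_) fun k hk => ?_⟩
  · exact PointedCone.smul_mem _ (hw k).le (PointedCone.subset_hull (hz k).1)
  · exact PointedCone.smul_mem _ (hw k).le
      (PointedCone.subset_hull (hswap i hi j hj _ (hz k).1))
  · simpa [hi, hj, (hw k).ne'] using hT' k hk

end SparseRepresentation

section Gordan

variable {ι : Type*}

/-- The real sequence underlying an integer sequence. -/
def toReal : (ι → ℤ) →+ (ι → ℝ) :=
  (Int.castAddHom ℝ).compLeft ι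

theorem toReal_apply (u : ι → ℤ) (i : ι) : toReal u i = u i :=
  rfl

theorem toReal_transfer [DecidableEq ι] (i j : ι) (t : ℤ) (u : ι → ℤ) :
    toReal (transfer i j t u) = transfer i j (t : ℝ) (toReal u) := by
  ext h
  simp only [transfer, toReal_apply, Pi.add_apply, Pi.sub_apply, Pi.single_apply]
  split_ifs <;> push_cast <;> ring

theorem support_toReal (u : ι → ℤ) : Function.support (toReal u) = Function.support u := by
  ext i
  simp [toReal_apply]

theorem exists_nsmul_eq_toReal {a : ι → ℝ} (ha : (Function.support a).Finite)
    (hq : ∀ i, ∃ q : ℚ, a i = q) : ∃ d : ℕ, d ≠ 0 ∧ ∃ z : ι → ℤ, d • a = toReal z := by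
  choose q hq using hq
  refine ⟨∏ i ∈ ha.toFinset, (q i).den, prod_ne_zero_iff.2 fun i _ => (q i).den_nz, ?_⟩
  have hz (i : ι) : ∃ z : ℤ, ((∏ j ∈ ha.toFinset, (q j).den : ℕ) : ℝ) * a i = z := by
    by_cases hi : a i = 0
    · exact ⟨0, by simp [hi]⟩
    obtain ⟨t, ht⟩ := dvd_prod_of_mem (fun j => (q j).den) (ha.mem_toFinset.2 hi)
    have hnum : ((q i).den : ℝ) * q i = (q i).num := mod_cast Rat.den_mul_eq_num (q i)
    refine ⟨t * (q i).num, ?_⟩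
    rw [ht, hq i]
    push_cast
    rw [← hnum]
    ring
  choose z hz using hz
  exact ⟨z, funext fun i => by rw [Pi.smul_apply, nsmul_eq_mul, hz i, toReal_apply]⟩

/-- `z` takes the integer parts of the coefficients of a representation of `u`. -/
theorem exists_mem_closure_toReal_sub_mem_hull {A : Finset (ι → ℤ)} {u : ι → ℤ}
    (hu : toReal u ∈ PointedCone.hull ℝ (toReal '' (A : Set (ι → ℤ)))) :
    ∃ z ∈ AddSubmonoid.closure (A : Set (ι → ℤ)),
      toReal (u - z) ∈ PointedCone.hull ℝ (toReal '' (A : Set (ι → ℤ))) ∧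
        |u - z| ≤ ∑ a ∈ A, |a| := by
  obtain ⟨c, hc⟩ := (Submodule.mem_span_image_finset_iff_exists_fun' _).1 hu
  set z : ι → ℤ := ∑ a ∈ A, ⌊(c a : ℝ)⌋₊ • a with hz
  have hsub : toReal (u - z) = ∑ a ∈ A, Int.fract (c a : ℝ) • toReal a := by
    have hfloor (a : ι → ℤ) : Int.fract (c a : ℝ) = c a - ⌊(c a : ℝ)⌋₊ := by
      rw [Int.fract, natCast_floor_eq_intCast_floor (c a).2]
    simp only [hz, map_sub, map_sum, map_nsmul, hfloor, sub_smul, sum_sub_distrib,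
      Nat.cast_smul_eq_nsmul, ← hc]
    rfl
  refine ⟨z, sum_mem fun a ha => nsmul_mem (AddSubmonoid.subset_closure ha) _, ?_, fun i => ?_⟩
  · rw [hsub]
    exact sum_mem fun a ha => PointedCone.smul_mem _ (Int.fract_nonneg _)
      (PointedCone.subset_hull (Set.mem_image_of_mem _ ha))
  · have hreal : |toReal (u - z) i| ≤ ∑ a ∈ A, |(a i : ℝ)| := by
      rw [hsub, Finset.sum_apply]
      refine (abs_sum_le_sum_abs _ _).trans (sum_le_sum fun a _ => ?_)
      rw [Pi.smul_apply, smul_eq_mul, abs_mul, Int.abs_fract]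
      exact mul_le_of_le_one_left (abs_nonneg _) (Int.fract_lt_one _).le
    simp only [toReal_apply] at hreal
    simp only [Pi.abs_apply, Finset.sum_apply]
    exact_mod_cast hreal

theorem finite_setOf_abs_le {B : ι → ℤ} (hB : (Function.support B).Finite) :
    {w : ι → ℤ | |w| ≤ B}.Finite := by
  classical
  let b := Finsupp.ofSupportFinite B hB
  refine ((Set.finite_Icc (-b) b).image (⇑)).subset fun w hw => ?_
  have hw' (i : ι) : |w i| ≤ B i := hw i
  have hsupp : Function.support w ⊆ Function.support B := fun i hi =>
    ((abs_pos.2 hi).trans_le (hw' i)).ne'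
  exact ⟨Finsupp.ofSupportFinite w (hB.subset hsupp),
    ⟨fun i => neg_le_of_abs_le (hw' i), fun i => le_of_abs_le (hw' i)⟩, rfl⟩

theorem exists_hull_toReal_image_eq {S : Set (ι → ℝ)} (hS : ∀ a ∈ S, (Function.support a).Finite)
    (hq : ∀ a ∈ S, ∀ i, ∃ q : ℚ, a i = q) (hfg : (PointedCone.hull ℝ S).FG) :
    ∃ A : Finset (ι → ℤ),
      PointedCone.hull ℝ (toReal '' (A : Set (ι → ℤ))) = PointedCone.hull ℝ S := by
  classical
  obtain ⟨T, hTS, hT : PointedCone.hull ℝ S = PointedCone.hull ℝ T⟩ :=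
    (Submodule.fg_span_iff_fg_span_finset_subset S).1 hfg
  choose! d hd z hz using fun a (ha : a ∈ T) =>
    exists_nsmul_eq_toReal (hS a (hTS ha)) (hq a (hTS ha))
  refine ⟨T.image z, ?_⟩
  rw [hT, coe_image]
  refine le_antisymm (Submodule.span_le.2 ?_) (Submodule.span_le.2 fun a ha => ?_)
  · rintro _ ⟨_, ⟨a, ha, rfl⟩, rfl⟩
    rw [← hz a ha]
    exact nsmul_mem (PointedCone.subset_hull ha) _
  · have hmem : toReal (z a) ∈ PointedCone.hull ℝ (toReal '' (z '' (T : Set (ι → ℝ)))) :=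
      PointedCone.subset_hull (Set.mem_image_of_mem _ (Set.mem_image_of_mem _ ha))
    rw [← hz a ha, ← Nat.cast_smul_eq_nsmul ℝ] at hmem
    exact (PointedCone.smul_mem_iff _ (Nat.cast_pos.2 (Nat.pos_of_ne_zero (hd a ha)))).1 hmem

theorem toReal_mem_coordSubspace {n : ℕ} {u : ℕ → ℤ} :
    toReal u ∈ coordSubspace ℝ n ↔ u ∈ coordSubspace ℤ n := by
  simp [coordSubspace, toReal_apply]

theorem finite_support_of_mem_coordSubspace {R : Type*} [Zero R] {n : ℕ} {u : ℕ → R}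
    (hu : u ∈ coordSubspace R n) : (Function.support u).Finite :=
  (Set.finite_Iio n).subset fun i hi => not_le.1 fun h => hi (hu i h)

theorem fg_latticePoints {n : ℕ} {C : PointedCone ℝ (ℕ → ℝ)}
    (hsub : (C : Set (ℕ → ℝ)) ⊆ coordSubspace ℝ n) (hfg : C.FG) (hrat : IsRationalCone C) :
    (latticePoints n C).FG := by
  obtain ⟨S, hS, rfl⟩ := hrat
  obtain ⟨A, hA⟩ := exists_hull_toReal_image_eq
    (fun a ha => finite_support_of_mem_coordSubspace (hsub (PointedCone.subset_hull ha))) hS hfg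
  rw [← hA] at hsub ⊢
  set C := PointedCone.hull ℝ (toReal '' (A : Set (ℕ → ℤ)))
  have hmem {u : ℕ → ℤ} (hu : toReal u ∈ C) : u ∈ latticePoints n C :=
    ⟨toReal_mem_coordSubspace.1 (hsub hu), hu⟩
  have hAM {a : ℕ → ℤ} (ha : a ∈ A) : a ∈ latticePoints n C :=
    hmem (PointedCone.subset_hull (Set.mem_image_of_mem _ ha))
  set T : Set (ℕ → ℤ) := {w | toReal w ∈ C ∧ |w| ≤ ∑ a ∈ A, |a|}
  have hT : T.Finite := by
    have hbound : ∑ a ∈ A, |a| ∈ coordSubspace ℤ n := fun i hi => by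
      rw [Finset.sum_apply]
      exact sum_eq_zero fun a ha => by rw [Pi.abs_apply, (hAM ha).1 i hi, abs_zero]
    exact (finite_setOf_abs_le (finite_support_of_mem_coordSubspace hbound)).subset
      fun w hw => hw.2
  refine (AddSubmonoid.fg_iff _).2 ⟨A ∪ T, le_antisymm ?_ fun u hu => ?_, A.finite_toSet.union hT⟩
  · exact AddSubmonoid.closure_le.2 (Set.union_subset (fun a ha => hAM ha) fun w hw => hmem hw.1)
  · obtain ⟨z, hz, hzC, hzA⟩ := exists_mem_closure_toReal_sub_mem_hull hu.2
    rw [← add_sub_cancel z u]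
    exact add_mem (AddSubmonoid.closure_mono Set.subset_union_left hz)
      (AddSubmonoid.subset_closure (Or.inr ⟨hzC, hzA⟩))

theorem isNormalMonoid_latticePoints (n : ℕ) (C : PointedCone ℝ (ℕ → ℝ)) :
    IsNormalMonoid (latticePoints n C) := by
  refine Set.Subset.antisymm (fun u hu => ⟨1, le_rfl, by rwa [one_smul]⟩) ?_
  rintro u ⟨k, hk, hu, huC : toReal (k • u) ∈ C⟩
  have hk0 : k ≠ 0 := Nat.one_le_iff_ne_zero.1 hk
  refine ⟨fun i hi => (smul_eq_zero.1 (hu i hi)).resolve_left hk0, ?_⟩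
  rw [map_nsmul, ← Nat.cast_smul_eq_nsmul ℝ] at huC
  exact (PointedCone.smul_mem_iff _ (Nat.cast_pos.2 hk)).1 huC

end Gordan

section Permutations

variable {R : Type*}

theorem swap_mem_symGroup {n i j : ℕ} (hi : i < n) (hj : j < n) : Equiv.swap i j ∈ symGroup n :=
  fun _ hk => Equiv.swap_apply_of_ne_of_ne (hi.trans_le hk).ne' (hj.trans_le hk).ne'

theorem exists_symGroup_eqOn {n : ℕ} {S : Set ℕ} {f : ℕ → ℕ} (hS : S ⊆ Set.Iio n)
    (hf : Set.MapsTo f S (Set.Iio n)) (hinj : Set.InjOn f S) :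
    ∃ σ ∈ symGroup n, Set.EqOn σ f S := by
  have hmaps : Set.MapsTo (fun i : range n => f i) ((↑) ⁻¹' S) (range n : Set ℕ) := fun i hi => by
    simpa using hf hi
  obtain ⟨g, hg⟩ := hmaps.exists_equiv_extend_of_card_eq (Fintype.card_coe _)
    fun i hi j hj h => Subtype.ext (hinj hi hj h)
  refine ⟨Equiv.Perm.ofSubtype g, fun i hi => ?_, fun i hi => ?_⟩
  · exact Equiv.Perm.ofSubtype_apply_of_not_mem g (by simpa using hi)
  · have hi' : i ∈ range n := mem_range.2 (hS hi)
    rw [Equiv.Perm.ofSubtype_apply_of_mem g hi', hg ⟨i, hi'⟩ hi]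

theorem permAct_inv_permAct (σ : Equiv.Perm ℕ) (u : ℕ → R) : permAct σ⁻¹ (permAct σ u) = u := by
  funext i
  simp [permAct]

theorem permAct_swap (i j : ℕ) (u : ℕ → R) : permAct (Equiv.swap i j) u = u ∘ Equiv.swap i j := by
  rw [← Equiv.swap_inv]
  rfl

theorem sum_permAct [AddCommMonoid R] {n : ℕ} {σ : Equiv.Perm ℕ} (hσ : σ ∈ symGroup n)
    (u : ℕ → R) : ∑ i ∈ range n, permAct σ u i = ∑ i ∈ range n, u i :=
  Equiv.Perm.sum_comp σ⁻¹ _ u fun i hi =>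
    by_contra fun h => hi ((symGroup n).inv_mem hσ i (by simpa using h))

theorem permAct_mem_closure [AddMonoid R] {F G : Set (ℕ → R)} {σ : Equiv.Perm ℕ}
    (hF : ∀ f ∈ F, permAct σ f ∈ G) {u : ℕ → R} (hu : u ∈ AddSubmonoid.closure F) :
    permAct σ u ∈ AddSubmonoid.closure G := by
  induction hu using AddSubmonoid.closure_induction with
  | mem f hf => exact AddSubmonoid.subset_closure (hF f hf)
  | zero => exact zero_mem _
  | add x y _ _ hx hy => exact add_mem hx hy

variable [Zero R]

theorem support_permAct (σ : Equiv.Perm ℕ) (u : ℕ → R) :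
    Function.support (permAct σ u) = σ '' Function.support u := by
  rw [Equiv.image_eq_preimage_symm]
  rfl

theorem mem_coordSubspace_iff {n : ℕ} {u : ℕ → R} :
    u ∈ coordSubspace R n ↔ Function.support u ⊆ Set.Iio n := by
  simp only [coordSubspace, Set.mem_ofPred_eq, Function.support_subset_iff', Set.mem_Iio, not_lt]

theorem coordSubspace_mono {m n : ℕ} (h : m ≤ n) : coordSubspace R m ⊆ coordSubspace R n :=
  fun _ hu i hi => hu i (h.trans hi)

theorem permAct_mem_coordSubspace {n : ℕ} {σ : Equiv.Perm ℕ} (hσ : σ ∈ symGroup n) {u : ℕ → R}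
    (hu : u ∈ coordSubspace R n) : permAct σ u ∈ coordSubspace R n := fun i hi => by
  rw [permAct, (symGroup n).inv_mem hσ i hi, hu i hi]

theorem permAct_congr {σ τ : Equiv.Perm ℕ} {u : ℕ → R}
    (h : Set.EqOn σ τ (Function.support u)) : permAct σ u = permAct τ u := by
  funext i
  by_cases hσ : u (σ⁻¹ i) = 0
  · by_cases hτ : u (τ⁻¹ i) = 0
    · exact hσ.trans hτ.symm
    · have hi : τ⁻¹ i = σ⁻¹ i :=
        Equiv.Perm.eq_inv_iff_eq.2 ((h hτ).trans (Equiv.apply_symm_apply τ i))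
      simp only [permAct, hi]
  · have hi : σ⁻¹ i = τ⁻¹ i :=
      Equiv.Perm.eq_inv_iff_eq.2 ((h hσ).symm.trans (Equiv.apply_symm_apply σ i))
    simp only [permAct, hi]

theorem exists_permAct_mem_coordSubspace {m n : ℕ} (hmn : m ≤ n) {u : ℕ → R}
    (hu : u ∈ coordSubspace R n) (hcard : (Function.support u).ncard ≤ m) :
    ∃ σ ∈ symGroup n, permAct σ u ∈ coordSubspace R m := by
  have hfin := finite_support_of_mem_coordSubspace hu
  obtain ⟨f, hf, hinj⟩ := hfin.exists_injOn_of_encard_le (t := Set.Iio m) (by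
    rw [← hfin.cast_ncard_eq, ← (Set.finite_Iio m).cast_ncard_eq]
    simpa using hcard)
  obtain ⟨σ, hσ, hσf⟩ := exists_symGroup_eqOn (mem_coordSubspace_iff.1 hu)
    (fun i hi => (hf hi).trans_le hmn) hinj
  refine ⟨σ, hσ, mem_coordSubspace_iff.2 ?_⟩
  rw [support_permAct, hσf.image_eq]
  exact Set.image_subset_iff.2 hf

theorem exists_symGroup_permAct_eq {m : ℕ} {u : ℕ → R} {σ : Equiv.Perm ℕ}
    (hu : u ∈ coordSubspace R m) (hσu : permAct σ u ∈ coordSubspace R m) :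
    ∃ τ ∈ symGroup m, permAct τ u = permAct σ u := by
  rw [mem_coordSubspace_iff, support_permAct] at hσu
  obtain ⟨τ, hτ, hτσ⟩ := exists_symGroup_eqOn (f := σ) (mem_coordSubspace_iff.1 hu)
    (Set.image_subset_iff.1 hσu) σ.injective.injOn
  exact ⟨τ, hτ, permAct_congr hτσ⟩

end Permutations

section Chain

variable {C : ℕ → PointedCone ℝ (ℕ → ℝ)} {m n r : ℕ}

theorem IsSymInvariantConeChain.permAct_mem (hchain : IsSymInvariantConeChain C) (hm : 1 ≤ m)
    (hmn : m ≤ n) {σ : Equiv.Perm ℕ} (hσ : σ ∈ symGroup n) {u : ℕ → ℝ} (hu : u ∈ C m) :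
    permAct σ u ∈ C n :=
  hchain.invariant m n hm hmn (PointedCone.subset_hull ⟨σ, hσ, u, hu, rfl⟩)

theorem nonneg_of_mem_symOrbit {R : Type*} [Zero R] [LE R] {A : Set (ℕ → R)} (hA : ∀ u ∈ A, 0 ≤ u)
    {v : ℕ → R} (hv : v ∈ symOrbit n A) : 0 ≤ v := by
  obtain ⟨σ, -, u, hu, rfl⟩ := hv
  exact fun i => hA u hu (σ⁻¹ i)

theorem nonneg_of_mem_latticePoints {D : PointedCone ℝ (ℕ → ℝ)} (hD : ∀ u ∈ D, 0 ≤ u)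
    {u : ℕ → ℤ} (hu : u ∈ latticePoints n D) : 0 ≤ u :=
  fun i => Int.cast_nonneg_iff.1 (hD _ hu.2 i)

theorem permAct_mem_symOrbit {R : Type*} {A : Set (ℕ → R)} {σ : Equiv.Perm ℕ}
    (hσ : σ ∈ symGroup n) {v : ℕ → R} (hv : v ∈ symOrbit n A) : permAct σ v ∈ symOrbit n A := by
  obtain ⟨τ, hτ, u, hu, rfl⟩ := hv
  exact ⟨σ * τ, mul_mem hσ hτ, u, hu, rfl⟩

theorem IsSymInvariantConeChain.mem_of_mem_coordSubspace (hchain : IsSymInvariantConeChain C)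
    (hr : 1 ≤ r) (hrm : r ≤ m) (hn : C n = PointedCone.hull ℝ (symOrbit n (C r)))
    (hnonneg : ∀ u ∈ C r, 0 ≤ u) {w : ℕ → ℝ} (hw : w ∈ C n) (hwm : w ∈ coordSubspace ℝ m) :
    w ∈ C m := by
  rw [hn] at hw
  refine Submodule.span_le.2 ?_ (mem_hull_support_subset_of_mem_hull
    (fun _ => nonneg_of_mem_symOrbit hnonneg) hw)
  rintro _ ⟨⟨σ, -, u, hu, rfl⟩, hsupp⟩
  obtain ⟨τ, hτ, hτσ⟩ := exists_symGroup_permAct_eq (m := m)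
    (coordSubspace_mono hrm (hchain.subset_coord r hr hu))
    (mem_coordSubspace_iff.2 (hsupp.trans (mem_coordSubspace_iff.1 hwm)))
  rw [← hτσ]
  exact hchain.permAct_mem hr hrm hτ hu

theorem permAct_mem_latticePoints (hchain : IsSymInvariantConeChain C) (hm : 1 ≤ m) (hmn : m ≤ n)
    {σ : Equiv.Perm ℕ} (hσ : σ ∈ symGroup n) {u : ℕ → ℤ} (hu : u ∈ latticePoints m (C m)) :
    permAct σ u ∈ latticePoints n (C n) :=
  ⟨permAct_mem_coordSubspace hσ (coordSubspace_mono hmn hu.1), hchain.permAct_mem hm hmn hσ hu.2⟩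

theorem isSymInvariantMonoidChain_latticePoints (hchain : IsSymInvariantConeChain C) :
    IsSymInvariantMonoidChain fun n => latticePoints n (C n) where
  subset_coord _ _ _ hu := hu.1
  invariant m n hm hmn := by
    refine AddSubmonoid.closure_le.2 ?_
    rintro _ ⟨σ, hσ, u, hu, rfl⟩
    exact permAct_mem_latticePoints hchain hm hmn hσ hu

theorem mem_symOrbit_latticePoints (hchain : IsSymInvariantConeChain C) (hr : 1 ≤ r)
    (hrm : r ≤ m) (hmn : m ≤ n) (hn : C n = PointedCone.hull ℝ (symOrbit n (C r)))
    (hnonneg : ∀ u ∈ C r, 0 ≤ u) {u : ℕ → ℤ} (hu : u ∈ latticePoints n (C n))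
    (hcard : (Function.support u).ncard ≤ m) : u ∈ symOrbit n (latticePoints m (C m)) := by
  obtain ⟨σ, hσ, hσu⟩ := exists_permAct_mem_coordSubspace hmn hu.1 hcard
  have hσC : toReal (permAct σ u) ∈ C n :=
    hchain.permAct_mem ((hr.trans hrm).trans hmn) le_rfl hσ hu.2
  exact ⟨σ⁻¹, (symGroup n).inv_mem hσ, permAct σ u,
    ⟨hσu, hchain.mem_of_mem_coordSubspace hr hrm hn hnonneg hσC (toReal_mem_coordSubspace.2 hσu)⟩,
    (permAct_inv_permAct σ u).symm⟩

theorem transfer_mem_coordSubspace {R : Type*} [AddCommGroup R] {i j : ℕ} (hi : i < n)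
    (hj : j < n) (t : R) {u : ℕ → R} (hu : u ∈ coordSubspace R n) :
    transfer i j t u ∈ coordSubspace R n := fun k hk => by
  rw [transfer_apply_of_ne (hi.trans_le hk).ne' (hj.trans_le hk).ne', hu k hk]

theorem isTransferClosed_latticePoints (hchain : IsSymInvariantConeChain C) (hn : 1 ≤ n) :
    IsTransferClosed (Set.Iio n) (latticePoints n (C n) : Set (ℕ → ℤ)) := by
  have hC : IsTransferClosed (Set.Iio n) (C n : Set (ℕ → ℝ)) :=
    isTransferClosed_of_convex (C n).convex fun i hi j hj u hu =>
      permAct_swap i j u ▸ hchain.permAct_mem hn le_rfl (swap_mem_symGroup hi hj) hu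
  intro i hi j hj u hu t ht
  refine ⟨transfer_mem_coordSubspace hi hj t hu.1, ?_⟩
  have ht' : (t : ℝ) ∈ Set.uIcc 0 (toReal u i - toReal u j) := by
    simp only [toReal_apply, Set.mem_uIcc] at ht ⊢
    exact_mod_cast ht
  have hmem := hC i hi j hj (toReal u) hu.2 t ht'
  rwa [← toReal_transfer] at hmem

theorem exists_transfer_self_mem_latticePoints (hchain : IsSymInvariantConeChain C) (hr : 1 ≤ r)
    (hn : C n = PointedCone.hull ℝ (symOrbit n (C r))) (hnonneg : ∀ u ∈ C r, 0 ≤ u) {u : ℕ → ℤ}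
    (hu : u ∈ latticePoints n (C n)) (hcard : r ^ 2 + 1 < (Function.support u).ncard) :
    ∃ i ∈ Set.Iio n, ∃ j ∈ Set.Iio n,
      i ≠ j ∧ u i ≠ 0 ∧ u j ≠ 0 ∧ transfer i j (u i) u ∈ latticePoints n (C n) := by
  have hsupp : Function.support (toReal u) ⊆ Set.Iio n :=
    mem_coordSubspace_iff.1 (toReal_mem_coordSubspace.2 hu.1)
  have hr' : ∀ b ∈ symOrbit n (C r : Set (ℕ → ℝ)), (Function.support b).ncard ≤ r := by
    rintro _ ⟨σ, -, v, hv, rfl⟩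
    rw [support_permAct, Set.ncard_image_of_injective _ σ.injective]
    simpa using Set.ncard_le_ncard
      (mem_coordSubspace_iff.1 (hchain.subset_coord r hr hv)) (Set.finite_Iio r)
  obtain ⟨i, hi, j, hj, hij, hmem⟩ := exists_transfer_self_mem_hull
    (fun _ => nonneg_of_mem_symOrbit hnonneg) hr'
    (fun i hi j hj _ hb => permAct_swap i j _ ▸
      permAct_mem_symOrbit (swap_mem_symGroup (hsupp hi) (hsupp hj)) hb)
    (hn ▸ hu.2) (support_toReal u ▸ hcard)
  rw [← hn, toReal_apply, ← toReal_transfer] at hmem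
  rw [support_toReal] at hi hj hsupp
  exact ⟨i, hsupp hi, j, hsupp hj, hij, hi, hj,
    transfer_mem_coordSubspace (hsupp hi) (hsupp hj) _ hu.1, hmem⟩

/-- The lattice points of `C` in `ℤ^n` with coordinate sum at most `K`, a generating set of
`latticePoints n C` for a suitable `K`. -/
def boundedLatticePoints (n : ℕ) (C : PointedCone ℝ (ℕ → ℝ)) (K : ℤ) : Set (ℕ → ℤ) :=
  {u | u ∈ latticePoints n C ∧ ∑ i ∈ range n, u i ≤ K}

theorem isTransferClosed_boundedLatticePoints (hchain : IsSymInvariantConeChain C) (hn : 1 ≤ n)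
    (K : ℤ) : IsTransferClosed (Set.Iio n) (boundedLatticePoints n (C n) K) :=
  fun i hi j hj u hu t ht => ⟨isTransferClosed_latticePoints hchain hn i hi j hj u hu.1 t ht,
    (sum_transfer (mem_range.2 hi) (mem_range.2 hj) t u).trans_le hu.2⟩

theorem permAct_mem_boundedLatticePoints (hchain : IsSymInvariantConeChain C) (hm : 1 ≤ m)
    (hmn : m ≤ n) {σ : Equiv.Perm ℕ} (hσ : σ ∈ symGroup n) {K : ℤ} {u : ℕ → ℤ}
    (hu : u ∈ boundedLatticePoints m (C m) K) : permAct σ u ∈ boundedLatticePoints n (C n) K := by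
  refine ⟨permAct_mem_latticePoints hchain hm hmn hσ hu.1, ?_⟩
  calc ∑ i ∈ range n, permAct σ u i = ∑ i ∈ range n, u i := sum_permAct hσ u
    _ = ∑ i ∈ range m, u i := (sum_subset (range_mono hmn) fun i _ hi =>
        hu.1.1 i (by simpa using hi)).symm
    _ ≤ K := hu.2

theorem exists_latticePoints_le_closure_boundedLatticePoints {D : PointedCone ℝ (ℕ → ℝ)}
    (hfg : (latticePoints n D).FG) :
    ∃ K, latticePoints n D ≤ AddSubmonoid.closure (boundedLatticePoints n D K) := by
  obtain ⟨F, hF⟩ := hfg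
  obtain ⟨K, hK⟩ := (F.image fun f => ∑ i ∈ range n, f i).exists_le
  refine ⟨K, hF.symm.trans_le (AddSubmonoid.closure_mono fun f hf => ⟨?_, ?_⟩)⟩
  · exact hF ▸ AddSubmonoid.subset_closure hf
  · exact hK _ (mem_image_of_mem _ hf)

theorem exists_forall_latticePoints_le_closure_boundedLatticePoints
    (hchain : IsSymInvariantConeChain C) (hr : 1 ≤ r)
    (hstab : ∀ n, r ≤ n → C n = PointedCone.hull ℝ (symOrbit n (C r)))
    (hnonneg : ∀ n, 1 ≤ n → ∀ u ∈ C n, 0 ≤ u)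
    (hfg : (latticePoints (r ^ 2 + 1) (C (r ^ 2 + 1))).FG) :
    ∃ K, ∀ n, r ^ 2 + 1 ≤ n →
      latticePoints n (C n) ≤ AddSubmonoid.closure (boundedLatticePoints n (C n) K) := by
  have hrR : r ≤ r ^ 2 + 1 := (Nat.le_self_pow two_ne_zero r).trans (Nat.le_succ _)
  obtain ⟨K, hK⟩ := exists_latticePoints_le_closure_boundedLatticePoints hfg
  refine ⟨K, fun n hRn => subset_closure_of_exists_transfer_self_mem (k := r ^ 2 + 1)
    (isTransferClosed_boundedLatticePoints hchain (Nat.le_of_add_left_le hRn) K)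
    (fun u hu => nonneg_of_mem_latticePoints (hnonneg n (Nat.le_of_add_left_le hRn)) hu)
    (fun u hu hcard => exists_transfer_self_mem_latticePoints hchain hr
      (hstab n (hrR.trans hRn)) (hnonneg r hr) hu hcard) fun u hu hcard => ?_⟩
  obtain ⟨σ, hσ, v, hv, rfl⟩ := mem_symOrbit_latticePoints hchain hr hrR hRn
    (hstab n (hrR.trans hRn)) (hnonneg r hr) hu hcard
  exact permAct_mem_closure (fun f hf =>
    permAct_mem_boundedLatticePoints hchain (Nat.le_add_left 1 _) hRn hσ hf) (hK hv)

theorem ncard_support_le_sum {ι : Type*} {s : Finset ι} {u : ι → ℤ} (hu : 0 ≤ u)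
    (hs : Function.support u ⊆ s) : ((Function.support u).ncard : ℤ) ≤ ∑ i ∈ s, u i := by
  classical
  have hsupp : Function.support u = ({i ∈ s | u i ≠ 0} : Finset ι) := by
    rw [coe_filter]
    exact Set.ext fun i => (and_iff_right_of_imp (@hs i)).symm
  rw [hsupp, Set.ncard_coe_finset, natCast_card_filter]
  refine sum_le_sum fun i _ => ?_
  split_ifs with hi
  · exact (hu i).lt_of_ne' hi
  · exact hu i

theorem monoidChainStabilizes_latticePoints (hchain : IsSymInvariantConeChain C)
    (hstab : ConeChainStabilizes C) (hnonneg : ∀ n, 1 ≤ n → ∀ u ∈ C n, 0 ≤ u)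
    (hfg : ∀ n, 1 ≤ n → (latticePoints n (C n)).FG) :
    MonoidChainStabilizes fun n => latticePoints n (C n) := by
  obtain ⟨r, hr, hstab⟩ := hstab
  obtain ⟨K, hK⟩ := exists_forall_latticePoints_le_closure_boundedLatticePoints hchain hr
    (fun n => hstab r n le_rfl) hnonneg (hfg _ (Nat.le_add_left 1 _))
  refine ⟨max (r ^ 2 + 1) K.toNat, le_max_of_le_left (Nat.le_add_left 1 _), fun m n hm hmn => ?_⟩
  obtain ⟨hRm, hKm⟩ := max_le_iff.1 hm
  have hm1 : 1 ≤ m := Nat.le_of_add_left_le hRm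
  have hrm : r ≤ m := (Nat.le_self_pow two_ne_zero r).trans (Nat.le_of_succ_le hRm)
  refine le_antisymm ((hK n (hRm.trans hmn)).trans (AddSubmonoid.closure_mono fun u hu => ?_))
    ((isSymInvariantMonoidChain_latticePoints hchain).invariant m n hm1 hmn)
  have hcard : ((Function.support u).ncard : ℤ) ≤ K :=
    (ncard_support_le_sum (nonneg_of_mem_latticePoints (hnonneg n (hm1.trans hmn)) hu.1)
      (by simpa using mem_coordSubspace_iff.1 hu.1.1)).trans hu.2
  exact mem_symOrbit_latticePoints hchain hr hrm hmn (hstab r n le_rfl (hrm.trans hmn))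
    (hnonneg r hr) hu.1 (by lia)

end Chain

end SymGordan

theorem mainTheorem9 (C : ℕ → PointedCone ℝ (ℕ → ℝ))
    (hchain : SymGordan.IsSymInvariantConeChain C)
    (hstab : SymGordan.ConeChainStabilizes C)
    (hfg : ∀ n, 1 ≤ n → (C n).FG)
    (hrat : ∀ n, 1 ≤ n → SymGordan.IsRationalCone (C n))
    (hnonneg : ∀ n, 1 ≤ n → ∀ u ∈ C n, ∀ i, 0 ≤ u i) :
    SymGordan.IsSymInvariantMonoidChain (fun n => SymGordan.latticePoints n (C n)) ∧
    SymGordan.MonoidChainStabilizes (fun n => SymGordan.latticePoints n (C n)) ∧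
    (∀ n, 1 ≤ n → (SymGordan.latticePoints n (C n)).FG) ∧
    (∀ n, 1 ≤ n → SymGordan.IsNormalMonoid (SymGordan.latticePoints n (C n))) := by
  have hfgM (n : ℕ) (hn : 1 ≤ n) : (SymGordan.latticePoints n (C n)).FG :=
    SymGordan.fg_latticePoints (hchain.subset_coord n hn) (hfg n hn) (hrat n hn)
  exact ⟨SymGordan.isSymInvariantMonoidChain_latticePoints hchain,
    SymGordan.monoidChainStabilizes_latticePoints hchain hstab hnonneg hfgM, hfgM,
    fun n _ => SymGordan.isNormalMonoid_latticePoints n (C n)⟩
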